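/- Let $G$ be a finite, nonempty bridgeless cubic planar graph; multiple edges are allowed, a loop counts twice in the degree of its end, and $G$ need not be connected. Fix any embedding of $G$ in the plane (vertices are distinct points, edges are simple arcs, loops simple closed curves, meeting vertices and other edges only at their ends). Call an edge $e$ of $G$ \emph{admissible} if the graph obtained from $G$ by deleting $e$ and smoothing out its two ends, which then have degree two, is again a bridgeless cubic graph. (Smoothing out a vertex $w$ with two edges $wx$, $wy$, where $x, y \neq w$, replaces $w$ and these edges by one edge $xy$, a loop if $x=y$; if the only edge at $w$ is a loop, then $w$ and its loop are removed. The graph without vertices counts as cubic and bridgeless.) Then for every face $F$ of the embedding, that is, for every connected component $F$ of the complement of the drawing in the plane, there is an admissible edge of $G$ that lies entirely on the boundary of $F$. -/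

import Mathlib

open scoped Graph

namespace Graph

variable {α β : Type*}

/-- The degree of the vertex `v` in the multigraph `G`; every loop at `v` counts twice. -/
noncomputable def eDegree (G : Graph α β) (v : α) : ℕ∞ :=
  {e | G.IsNonloopAt e v}.encard + 2 * {e | G.IsLoopAt e v}.encard

/-- `G` is cubic: all its vertices have degree three. -/
def IsCubic (G : Graph α β) : Prop :=
  ∀ v ∈ V(G), G.eDegree v = 3

/-- The vertices `x` and `y` are joined by a walk in `G`. -/
def Joined (G : Graph α β) (x y : α) : Prop :=
  Relation.ReflTransGen G.Adj x y

/-- The edge `e` is a bridge of `G`: its ends lie in different components of `G - e`. -/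
def IsBridge (G : Graph α β) (e : β) : Prop :=
  ∃ x y, G.IsLink e x y ∧ ¬ (G.deleteEdges {e}).Joined x y

/-- `G` has no bridge. (It may be disconnected.) -/
def IsBridgeless (G : Graph α β) : Prop :=
  ∀ e, ¬ G.IsBridge e

/-- `H'` arises from `H` by smoothing out the vertex `w` of degree two.

* If `w` has two distinct edges `f`, `g`, with other ends `x`, `y`, then `w`, `f`, `g` are replaced
  by a single edge from `x` to `y`, which is a loop when `x = y`; the new edge reuses the name `f`.
* If the only edge at `w` is a loop, then `w` and this loop form a whole component. Smoothing turns
  it into a closed curve without vertices, which is not part of a graph any more. -/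
def IsSmoothing (H : Graph α β) (w : α) (H' : Graph α β) : Prop :=
  (∃ f g x y, f ≠ g ∧ x ≠ w ∧ y ≠ w ∧ H.IsLink f w x ∧ H.IsLink g w y ∧
    (∀ h, H.Inc h w → h = f ∨ h = g) ∧
    V(H') = V(H) \ {w} ∧
    ∀ h a b, H'.IsLink h a b ↔
      (H.deleteVerts {w}).IsLink h a b ∨ (h = f ∧ s(a, b) = s(x, y))) ∨
  (∃ f, H.IsLoopAt f w ∧ (∀ h, H.Inc h w → h = f) ∧ H' = H.deleteVerts {w})

/-- `G'` arises from `G` by deleting the edge `e` and smoothing out its two ends, which have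
degree two after the deletion. -/
def IsEdgeReduction (G : Graph α β) (e : β) (G' : Graph α β) : Prop :=
  ∃ u v H, G.IsLink e u v ∧ (G.deleteEdges {e}).IsSmoothing u H ∧ H.IsSmoothing v G'

/-- The edge `e` of `G` is admissible: deleting it and smoothing out its ends leaves a bridgeless
cubic graph. -/
def IsAdmissible (G : Graph α β) (e : β) : Prop :=
  ∃ G' : Graph α β, G.IsEdgeReduction e G' ∧ G'.IsCubic ∧ G'.IsBridgeless

/-- An embedding of the multigraph `G` in the plane, which is `ℂ` with its usual topology.
Vertices are drawn as distinct points, an edge that is not a loop as a simple arc between its ends,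
a loop as a simple closed curve through its end, and a curve meets the vertices and the other
curves only at its ends. The values of `point` and `curve` outside `V(G)` and `E(G)` are irrelevant. -/
structure PlaneEmbedding (G : Graph α β) where
  /-- The point that represents a vertex. -/
  point : α → ℂ
  /-- The curve that represents an edge. -/
  curve : β → unitInterval → ℂ
  point_injOn : Set.InjOn point V(G)
  continuous_curve : ∀ e ∈ E(G), Continuous (curve e)
  curve_ends : ∀ e ∈ E(G), ∃ x y, G.IsLink e x y ∧ curve e 0 = point x ∧ curve e 1 = point y
  curve_simple : ∀ e ∈ E(G), ∀ s t, curve e s = curve e t →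
    s = t ∨ (s = 0 ∧ t = 1) ∨ (s = 1 ∧ t = 0)
  curve_ne_point : ∀ e ∈ E(G), ∀ v ∈ V(G), ∀ t ∈ Set.Ioo (0 : unitInterval) 1,
    curve e t ≠ point v
  curve_disjoint : ∀ e ∈ E(G), ∀ f ∈ E(G), e ≠ f →
    ∀ s ∈ Set.Ioo (0 : unitInterval) 1, ∀ t ∈ Set.Ioo (0 : unitInterval) 1,
      curve e s ≠ curve f t

namespace PlaneEmbedding

variable {G : Graph α β}

/-- The point set of the drawing: all vertices and all edges. -/
def support (D : G.PlaneEmbedding) : Set ℂ :=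
  D.point '' V(G) ∪ ⋃ e ∈ E(G), Set.range (D.curve e)

/-- `F` is a face: a connected component of the complement of the drawing. -/
def IsFace (D : G.PlaneEmbedding) (F : Set ℂ) : Prop :=
  ∃ z ∈ D.supportᶜ, F = connectedComponentIn D.supportᶜ z

/-- The edge `e` lies on the boundary of `F`. -/
def IsBoundaryEdge (D : G.PlaneEmbedding) (F : Set ℂ) (e : β) : Prop :=
  e ∈ E(G) ∧ Set.range (D.curve e) ⊆ frontier F

end PlaneEmbedding

end Graph

/-! Deleting `e` and smoothing its ends keeps the graph cubic, and smoothing creates no bridge. So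
`e` is admissible as soon as `G - e` is bridgeless, that is, as soon as `e` lies in no cut with two
edges. The task is to find such an edge on the boundary of `F`.

The topology supplies two facts: some edge lies on the boundary, and at each end of a boundary edge
there is another one (`exists_isBoundaryEdge_inc`). No facial cycles and no Jordan curve theorem are
needed. Both facts come from one separation principle, `mem_component_union_arc`: an arc meeting a
compact set `K` in at most one point separates no points that `K` leaves together. It follows from
Eilenberg's criterion: `K` does not separate `z` from `w` iff `(x - z) / (x - w)` has a continuous
logarithm on `K`.

The rest is uncrossing (`exists_deleteEdges_isBridgeless`). If every boundary edge were in a 2-edge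
cut, take a minimal side `A` of a 2-edge cut through a boundary edge `e`, and a second boundary edge
`p` at the end of `e` in `A`. Bridgelessness puts `p` inside `A`. Submodularity against a 2-edge cut
through `p` then yields a smaller side or contradicts that `e` leaves `A`. -/

/-! ### Separation in the plane by continuous logarithms. -/

namespace PlaneSeparation

open Set Complex Topology

/-- On `K`, the quotient `(x - z) / (x - w)` has a continuous logarithm. -/
def HasLogOn (K : Set ℂ) (z w : ℂ) : Prop :=
  ∃ φ : ℂ → ℂ, ContinuousOn φ K ∧ ∀ x ∈ K, exp (φ x) * (x - w) = x - z

lemma HasLogOn.symm {K : Set ℂ} {z w : ℂ} (h : HasLogOn K z w) : HasLogOn K w z := by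
  obtain ⟨φ, hφ, h⟩ := h
  refine ⟨fun x ↦ -φ x, hφ.neg, fun x hx ↦ ?_⟩
  rw [← h x hx, ← mul_assoc, ← exp_add]
  simp

lemma HasLogOn.trans {K : Set ℂ} {z w v : ℂ} (h₁ : HasLogOn K z w) (h₂ : HasLogOn K w v) :
    HasLogOn K z v := by
  obtain ⟨φ, hφ, h₁⟩ := h₁
  obtain ⟨ψ, hψ, h₂⟩ := h₂
  refine ⟨fun x ↦ φ x + ψ x, hφ.add hψ, fun x hx ↦ ?_⟩
  rw [← h₁ x hx, ← h₂ x hx, exp_add, mul_assoc]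

/-- The quotient `(x - w) / (x - z) = 1 + (z - w) / (x - z)` stays in the unit disc about `1`, where
the principal logarithm is continuous. -/
lemma hasLogOn_of_near {K : Set ℂ} {z w : ℂ} (h : ∀ x ∈ K, ‖z - w‖ < ‖x - z‖) :
    HasLogOn K w z := by
  have hne : ∀ x ∈ K, x - z ≠ 0 := fun x hx h0 ↦ by
    have := h x hx
    rw [h0, norm_zero] at this
    exact absurd this (norm_nonneg _).not_gt
  have hslit : ∀ x ∈ K, 1 + (z - w) / (x - z) ∈ slitPlane := fun x hx ↦ by
    apply mem_slitPlane_of_norm_lt_one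
    rw [norm_div, div_lt_one ((norm_nonneg _).trans_lt (h x hx))]
    exact h x hx
  refine ⟨fun x ↦ log (1 + (z - w) / (x - z)), ?_, fun x hx ↦ ?_⟩
  · refine ContinuousOn.clog ?_ hslit
    exact continuousOn_const.add (continuousOn_const.div (by fun_prop) hne)
  · rw [exp_log (slitPlane_ne_zero (hslit x hx))]
    have := hne x hx
    field_simp
    ring

/-- Points in the same component of the complement have a logarithm. -/
lemma hasLogOn_of_mem_component {K : Set ℂ} (hK : IsClosed K) {z w : ℂ}
    (hw : w ∈ connectedComponentIn Kᶜ z) : HasLogOn K z w := by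
  have hz : z ∈ Kᶜ := connectedComponentIn_nonempty_iff.1 ⟨w, hw⟩
  -- Having a logarithm is an equivalence relation that holds between nearby points off `K`, hence
  -- throughout a connected set.
  refine (isPreconnected_connectedComponentIn (F := Kᶜ) (x := z)).induction₂
    (fun z w ↦ HasLogOn K z w) (fun x hx ↦ ?_) (fun _ _ _ _ _ _ h h' ↦ h.trans h')
    (fun _ _ _ _ h ↦ h.symm) (mem_connectedComponentIn hz) hw
  obtain ⟨ε, hε, hball⟩ :=
    Metric.isOpen_iff.1 hK.isOpen_compl x (connectedComponentIn_subset _ _ hx)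
  refine mem_nhdsWithin_of_mem_nhds (Filter.mem_of_superset (Metric.ball_mem_nhds x hε) ?_)
  intro y hy
  refine (hasLogOn_of_near fun u hu ↦ ?_).symm
  have h1 : ε ≤ ‖u - x‖ := by
    by_contra! hlt
    exact hball (by simpa [dist_eq_norm] using hlt : u ∈ Metric.ball x ε) hu
  rw [mem_ball_iff_norm'] at hy
  exact hy.trans_le h1

lemma isPreconnected_compl_closedBall (z : ℂ) {R : ℝ} (hR : 0 < R) :
    IsPreconnected (Metric.closedBall z R)ᶜ := by
  have h : (Metric.closedBall z R)ᶜ = (fun s ↦ z + exp s) '' {s | Real.log R < s.re} := by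
    ext x
    simp only [mem_compl_iff, Metric.mem_closedBall, dist_eq_norm, not_le, mem_image, mem_ofPred_eq]
    constructor
    · intro hx
      have hx0 : x - z ≠ 0 := norm_pos_iff.1 (hR.trans hx)
      refine ⟨log (x - z), ?_, by rw [exp_log hx0]; ring⟩
      rw [log_re]
      exact Real.log_lt_log hR hx
    · rintro ⟨s, hs, rfl⟩
      rw [add_sub_cancel_left, norm_exp, ← Real.exp_log hR]
      exact Real.exp_lt_exp.2 hs
  rw [h]
  exact (convex_halfSpace_re_gt _).isPreconnected.image _ (by fun_prop)

/-- A continuous nonvanishing function on a real normed space has a continuous logarithm. -/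
lemma exists_log {E : Type*} [NormedAddCommGroup E] [NormedSpace ℝ E] {g : E → ℂ}
    (hg : Continuous g) (h0 : ∀ x, g x ≠ 0) :
    ∃ f : E → ℂ, Continuous f ∧ ∀ x, exp (f x) = g x := by
  have := (convex_univ (𝕜 := ℝ) (E := E)).contractibleSpace univ_nonempty
  have hs : IsSimplyConnected (univ : Set E) :=
    show SimplyConnectedSpace (univ : Set E) from inferInstance
  obtain ⟨f, hf, hfg⟩ := exists_continuousOn_eqOn_exp_comp hs isOpen_univ hg.continuousOn
    (by simpa using h0)
  exact ⟨f, continuousOn_univ.1 hf, fun x ↦ hfg (mem_univ x)⟩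

/-- The identity has no continuous logarithm on a circle about the origin. -/
lemma not_exists_log_on_sphere {z : ℂ} {R : ℝ} (hR : 0 < R) {L : ℂ → ℂ}
    (hL : Continuous L) (h : ∀ x, ‖x - z‖ = R → exp (L x) = x - z) : False := by
  -- Along the circle `g` is a logarithm of the constant `R`, hence constant by uniqueness of lifts.
  -- But after one turn `L` returns to its value while `t * I` has grown by `2πi`.
  let g : ℝ → ℂ := fun t ↦ L (z + R * exp (t * I)) - t * I
  have hg : Continuous g := by fun_prop
  have hexp : ∀ t, exp (g t) = R := fun t ↦ by
    have := h (z + R * exp (t * I)) (by simp [norm_exp_ofReal_mul_I, abs_of_pos hR])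
    simp only [g, exp_sub, this]
    field_simp
    simp
  have hconst : ∀ t, g t = g 0 := by
    obtain ⟨F, -, hF⟩ := isCoveringMapOn_exp.existsUnique_continuousMap_lifts
      (ContinuousMap.const ℝ (R : ℂ)) (a₀ := 0) (hexp 0) (fun _ ↦ by simpa using hR.ne')
    have h1 := hF ⟨g, hg⟩ ⟨rfl, funext hexp⟩
    have h2 := hF (ContinuousMap.const ℝ (g 0)) ⟨rfl, funext fun _ ↦ hexp 0⟩
    exact fun t ↦ congr($(h1.trans h2.symm) t)
  have h1 := hconst (2 * Real.pi)
  simp only [g] at h1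
  have h2 : exp (((2 * Real.pi : ℝ) : ℂ) * I) = 1 := by
    push_cast
    exact exp_two_pi_mul_I
  rw [h2] at h1
  simp [Real.pi_ne_zero] at h1

lemma mem_component_of_mem_closure {K : Set ℂ} (hK : IsClosed K) {z x : ℂ} (hxK : x ∉ K)
    (hx : x ∈ closure (connectedComponentIn Kᶜ z)) : x ∈ connectedComponentIn Kᶜ z := by
  obtain ⟨y, hyx, hyz⟩ := mem_closure_iff.1 hx _ (hK.isOpen_compl.connectedComponentIn (x := x))
    (mem_connectedComponentIn hxK)
  rw [connectedComponentIn_eq hyz, ← connectedComponentIn_eq hyx]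
  exact mem_connectedComponentIn hxK

lemma frontier_component_subset {K : Set ℂ} (hK : IsClosed K) (z : ℂ) :
    frontier (connectedComponentIn Kᶜ z) ⊆ K := by
  intro x hx
  by_contra hxK
  have := hx.2
  rw [hK.isOpen_compl.connectedComponentIn.interior_eq] at this
  exact this (mem_component_of_mem_closure hK hxK hx.1)

/-- Without a logarithm there is no separation: the case of a bounded component. -/
lemma mem_component_of_hasLogOn_of_isBounded {K : Set ℂ} (hK : IsClosed K) {z w : ℂ} (hz : z ∉ K)
    (hlog : HasLogOn K z w) (hb : Bornology.IsBounded (connectedComponentIn Kᶜ z)) :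
    w ∈ connectedComponentIn Kᶜ z := by
  classical
  by_contra hw
  set U := connectedComponentIn Kᶜ z with hU
  have hzU : z ∈ U := mem_connectedComponentIn hz
  have hUo : IsOpen U := hK.isOpen_compl.connectedComponentIn
  have hfr : frontier U ⊆ K := frontier_component_subset hK z
  obtain ⟨φ, hφ, hlog⟩ := hlog
  -- Tietze extends the logarithm to the plane. The two formulas for `f` agree on the frontier of
  -- `U`, and `f` has no zero since `z ∈ U` and `w ∉ U`. So `f` has a global logarithm, although it
  -- equals `x - z` on a large circle.
  obtain ⟨Φ, hΦ⟩ := ContinuousMap.exists_restrict_eq hK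
    ⟨K.domRestrict φ, continuousOn_iff_continuous_domRestrict.1 hφ⟩
  have hΦ' : ∀ x ∈ K, Φ x = φ x := fun x hx ↦ congr($hΦ ⟨x, hx⟩)
  let f : ℂ → ℂ := fun x ↦ if x ∈ U then exp (Φ x) * (x - w) else x - z
  have hf : Continuous f := by
    refine continuous_if (fun x hx ↦ ?_) ?_ ?_
    · have hxK := hfr hx
      rw [hΦ' x hxK, hlog x hxK]
    · fun_prop
    · fun_prop
  have hf0 : ∀ x, f x ≠ 0 := by
    intro x
    by_cases hx : x ∈ U
    · simp only [f, if_pos hx]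
      exact mul_ne_zero (exp_ne_zero _) (sub_ne_zero.2 fun h ↦ hw (h ▸ hx))
    · simp only [f, if_neg hx]
      exact sub_ne_zero.2 fun h ↦ hx (h ▸ hzU)
  obtain ⟨L, hL, hLf⟩ := exists_log hf hf0
  obtain ⟨R, hR, hUR⟩ := hb.subset_ball_lt 0 z
  refine not_exists_log_on_sphere hR hL (z := z) fun x hx ↦ ?_
  have hxU : x ∉ U := fun h ↦ by
    have := hUR h
    rw [mem_ball_iff_norm] at this
    exact this.ne hx
  rw [hLf x]
  simp only [f, if_neg hxU]

/-- If one of the two components is bounded, the previous lemma applies, by symmetry. Two unbounded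
components both contain the exterior of a disc around `K`, so they coincide. -/
lemma mem_component_of_hasLogOn {K : Set ℂ} (hK : IsCompact K) {z w : ℂ} (hz : z ∉ K)
    (hw : w ∉ K) (hlog : HasLogOn K z w) : w ∈ connectedComponentIn Kᶜ z := by
  obtain ⟨R, hR, hKR⟩ := hK.isBounded.subset_closedBall_lt 0 0
  have hpre := isPreconnected_compl_closedBall 0 hR
  have hsub : (Metric.closedBall (0 : ℂ) R)ᶜ ⊆ Kᶜ := compl_subset_compl.2 hKR
  have hbdd : ∀ u, ¬ Bornology.IsBounded (connectedComponentIn Kᶜ u) →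
      (Metric.closedBall (0 : ℂ) R)ᶜ ⊆ connectedComponentIn Kᶜ u := by
    intro u hu
    obtain ⟨x, hx, hxR⟩ : ∃ x ∈ connectedComponentIn Kᶜ u, x ∉ Metric.closedBall (0 : ℂ) R := by
      by_contra! h
      exact hu (Metric.isBounded_closedBall.subset h)
    rw [connectedComponentIn_eq hx]
    exact hpre.subset_connectedComponentIn hxR hsub
  by_cases h1 : Bornology.IsBounded (connectedComponentIn Kᶜ z)
  · exact mem_component_of_hasLogOn_of_isBounded hK.isClosed hz hlog h1
  by_cases h2 : Bornology.IsBounded (connectedComponentIn Kᶜ w)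
  · have := mem_component_of_hasLogOn_of_isBounded hK.isClosed hw hlog.symm h2
    rw [← connectedComponentIn_eq this]
    exact mem_connectedComponentIn hw
  · obtain ⟨x, hx⟩ : (Metric.closedBall (0 : ℂ) R)ᶜ.Nonempty := by
      refine ⟨((R + 1 : ℝ) : ℂ), ?_⟩
      simp only [mem_compl_iff, mem_closedBall_zero_iff, norm_real, Real.norm_eq_abs, not_le]
      exact (lt_add_one R).trans_le (le_abs_self _)
    rw [connectedComponentIn_eq (hbdd z h1 hx), ← connectedComponentIn_eq (hbdd w h2 hx)]
    exact mem_connectedComponentIn hw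

/-- There is a logarithm on a simple arc. -/
lemma hasLogOn_arc {c : unitInterval → ℂ} (hc : Continuous c) {s t : unitInterval} (hst : s ≤ t)
    (hinj : InjOn c (Icc s t)) {z w : ℂ} (hz : z ∉ c '' Icc s t) (hw : w ∉ c '' Icc s t) :
    HasLogOn (c '' Icc s t) z w := by
  -- Clamping the parameter extends the arc to all of `ℝ`, where `exists_log` applies.
  let γ : ℝ → ℂ := fun r ↦ c (projIcc s t hst (projIcc 0 1 zero_le_one r))
  have hγ : Continuous γ := by
    refine hc.comp (continuous_subtype_val.comp (continuous_projIcc.comp continuous_projIcc))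
  have hγmem : ∀ r, γ r ∈ c '' Icc s t := fun r ↦ mem_image_of_mem _ (Subtype.coe_prop _)
  have hne : ∀ {u}, u ∉ c '' Icc s t → ∀ r, γ r - u ≠ 0 := fun hu r ↦
    sub_ne_zero.2 fun h ↦ hu (h ▸ hγmem r)
  obtain ⟨L, hL, hLγ⟩ := exists_log (g := fun r ↦ (γ r - z) / (γ r - w))
    ((hγ.sub continuous_const).div (hγ.sub continuous_const) (hne hw))
    (fun r ↦ div_ne_zero (hne hz r) (hne hw r))
  -- A simple arc is embedded, so a function of the parameter is a continuous function on the arc,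
  -- and Tietze extends it.
  have hemb : IsClosedEmbedding ((Icc s t).domRestrict c) :=
    (hc.comp continuous_subtype_val).isClosedEmbedding (injOn_iff_injective.1 hinj)
  obtain ⟨Φ, hΦ⟩ := ContinuousMap.exists_extension hemb
    ⟨fun r : Icc s t ↦ L (r : unitInterval), by fun_prop⟩
  refine ⟨Φ, Φ.continuous.continuousOn, ?_⟩
  rintro _ ⟨r, hr, rfl⟩
  have h1 : Φ (c r) = L r := congr($hΦ ⟨r, hr⟩)
  have h2 : γ r = c r := by
    simp only [γ]
    rw [projIcc_val, projIcc_of_mem hst hr]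
  have h3 : c r - w ≠ 0 := h2 ▸ hne hw r
  rw [h1, hLγ, h2, div_mul_cancel₀ _ h3]

/-- At the only possible common point the two logarithms differ by some `d` with `exp d = 1`;
shifting one of them by `d` makes them fit together. -/
lemma HasLogOn.union {K γ : Set ℂ} (hK : IsClosed K) (hγ : IsClosed γ)
    (hsub : (K ∩ γ).Subsingleton) {z w : ℂ} (hwK : w ∉ K)
    (h₁ : HasLogOn K z w) (h₂ : HasLogOn γ z w) : HasLogOn (K ∪ γ) z w := by
  classical
  obtain ⟨φ, hφ, h₁⟩ := h₁
  obtain ⟨ψ, hψ, h₂⟩ := h₂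
  obtain ⟨d, hd, hd1⟩ : ∃ d : ℂ, (∀ x ∈ K ∩ γ, φ x = ψ x + d) ∧ exp d = 1 := by
    rcases (K ∩ γ).eq_empty_or_nonempty with h | ⟨p, hp⟩
    · exact ⟨0, by simp [h], exp_zero⟩
    · refine ⟨φ p - ψ p, fun x hx ↦ by rw [hsub hx hp]; ring, ?_⟩
      have hpw : p - w ≠ 0 := sub_ne_zero.2 fun h ↦ hwK (h ▸ hp.1)
      have := (h₁ p hp.1).trans (h₂ p hp.2).symm
      rw [exp_sub, mul_right_cancel₀ hpw this, div_self (exp_ne_zero _)]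
  refine ⟨fun x ↦ if x ∈ K then φ x else ψ x + d, ?_, ?_⟩
  · refine ContinuousOn.union_of_isClosed (hφ.congr fun x hx ↦ if_pos hx) ?_ hK hγ
    refine (hψ.add (continuousOn_const (c := d))).congr fun x hx ↦ ?_
    by_cases hxK : x ∈ K
    · simp only [if_pos hxK, hd x ⟨hxK, hx⟩, Pi.add_apply]
    · simp only [if_neg hxK, Pi.add_apply]
  · intro x hx
    by_cases hxK : x ∈ K
    · simp only [if_pos hxK, h₁ x hxK]
    · simp only [if_neg hxK, exp_add, hd1, mul_one, h₂ x (hx.resolve_left hxK)]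

/-- A simple arc that meets a compact set in at most one point does not separate points which the
compact set does not separate. -/
lemma mem_component_union_arc {K : Set ℂ} (hK : IsCompact K) {c : unitInterval → ℂ}
    (hc : Continuous c) {s t : unitInterval} (hst : s ≤ t) (hinj : InjOn c (Icc s t))
    (hsub : (K ∩ c '' Icc s t).Subsingleton) {z w : ℂ} (hz : z ∉ c '' Icc s t)
    (hw : w ∉ c '' Icc s t) (hzw : w ∈ connectedComponentIn Kᶜ z) :
    w ∈ connectedComponentIn (K ∪ c '' Icc s t)ᶜ z := by
  have hzK : z ∉ K := connectedComponentIn_nonempty_iff.1 ⟨w, hzw⟩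
  have hwK : w ∉ K := connectedComponentIn_subset _ _ hzw
  have hγ : IsCompact (c '' Icc s t) := isCompact_Icc.image hc
  refine mem_component_of_hasLogOn (hK.union hγ) (by rintro (h | h) <;> contradiction)
    (by rintro (h | h) <;> contradiction) ?_
  exact HasLogOn.union hK.isClosed hγ.isClosed hsub hwK
    (hasLogOn_of_mem_component hK.isClosed hzw) (hasLogOn_arc hc hst hinj hz hw)

/-- A set that contains the frontier of `F` separates `F` from all points outside of `F`. -/
lemma mem_of_mem_component_of_frontier_subset {F K : Set ℂ}
    (hFK : frontier F ⊆ K) {z w : ℂ}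
    (hz : z ∈ F) (hw : w ∈ connectedComponentIn Kᶜ z) : w ∈ F := by
  by_contra hwF
  set C := connectedComponentIn Kᶜ z
  have hzC : z ∈ C := mem_connectedComponentIn (connectedComponentIn_nonempty_iff.1 ⟨w, hw⟩)
  have hfr : ∀ x ∈ C, x ∉ frontier F := fun x hx hxF ↦ connectedComponentIn_subset _ _ hx (hFK hxF)
  have hint : ∀ x ∈ C, x ∈ closure F → x ∈ interior F := fun x hx hxF ↦ by
    by_contra h
    exact hfr x hx ⟨hxF, h⟩
  obtain ⟨x, -, hx, hx'⟩ := isPreconnected_connectedComponentIn (interior F) (closure F)ᶜ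
    isOpen_interior isClosed_closure.isOpen_compl
    (fun x hx ↦ (em (x ∈ closure F)).imp (hint x hx) id)
    ⟨z, hzC, hint z hzC (subset_closure hz)⟩
    ⟨w, hw, fun h ↦ hwF (interior_subset (hint w hw h))⟩
  exact hx' (subset_closure (interior_subset hx))

end PlaneSeparation

/-! ### Edges on the boundary of a face. -/

namespace Graph.PlaneEmbedding

open Set Topology PlaneSeparation

variable {α β : Type*} {G : Graph α β} (D : G.PlaneEmbedding) {F : Set ℂ}

/-- The part of the drawing that consists of the vertices in `X` and the edges in `Y`. -/
def drawing (X : Set α) (Y : Set β) : Set ℂ :=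
  D.point '' X ∪ ⋃ e ∈ Y, range (D.curve e)

variable {D} in
lemma mem_drawing {X : Set α} {Y : Set β} {x : ℂ} :
    x ∈ D.drawing X Y ↔ (∃ v ∈ X, D.point v = x) ∨ ∃ e ∈ Y, ∃ t, D.curve e t = x := by
  simp [drawing]

variable {D} in
lemma mem_support {x : ℂ} :
    x ∈ D.support ↔ (∃ v ∈ V(G), D.point v = x) ∨ ∃ e ∈ E(G), ∃ t, D.curve e t = x :=
  mem_drawing

lemma drawing_subset_support {X : Set α} {Y : Set β} (hX : X ⊆ V(G)) (hY : Y ⊆ E(G)) :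
    D.drawing X Y ⊆ D.support :=
  union_subset_union (image_mono hX) (biUnion_mono hY fun _ _ ↦ Subset.rfl)

lemma isCompact_drawing {X : Set α} {Y : Set β} (hX : X.Finite) (hY : Y.Finite) (hYE : Y ⊆ E(G)) :
    IsCompact (D.drawing X Y) :=
  (hX.image _).isCompact.union
    (hY.isCompact_biUnion fun e he ↦ isCompact_range (D.continuous_curve e (hYE he)))

lemma isCompact_support (hV : V(G).Finite) (hE : E(G).Finite) : IsCompact D.support :=
  D.isCompact_drawing hV hE Subset.rfl

lemma curve_mem_support {e : β} (he : e ∈ E(G)) (t : unitInterval) : D.curve e t ∈ D.support :=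
  mem_support.2 (.inr ⟨e, he, t, rfl⟩)

lemma eq_zero_or_eq_one_or_mem_Ioo (t : unitInterval) : t = 0 ∨ t = 1 ∨ t ∈ Ioo 0 1 := by
  rcases (unitInterval.nonneg' (t := t)).eq_or_lt with h | h
  · exact .inl h.symm
  rcases (unitInterval.le_one' (t := t)).eq_or_lt with h' | h'
  · exact .inr (.inl h')
  · exact .inr (.inr ⟨h, h'⟩)

lemma curve_eq_point_or_mem_Ioo {e : β} (he : e ∈ E(G)) (t : unitInterval) :
    (∃ v, G.Inc e v ∧ D.curve e t = D.point v) ∨ t ∈ Ioo 0 1 := by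
  obtain ⟨x, y, hxy, h0, h1⟩ := D.curve_ends e he
  rcases eq_zero_or_eq_one_or_mem_Ioo t with rfl | rfl | h
  · exact .inl ⟨x, hxy.inc_left, h0⟩
  · exact .inl ⟨y, hxy.inc_right, h1⟩
  · exact .inr h

lemma exists_curve_eq_point {e : β} {v : α} (h : G.Inc e v) :
    D.curve e 0 = D.point v ∨ D.curve e 1 = D.point v := by
  obtain ⟨x, y, hxy, h0, h1⟩ := D.curve_ends e h.edge_mem
  rcases h.eq_or_eq_of_isLink hxy with rfl | rfl
  · exact .inl h0
  · exact .inr h1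

/-- An inner point of an edge lies on no vertex and on no other edge. -/
lemma curve_notMem_drawing {X : Set α} {Y : Set β} (hX : X ⊆ V(G)) (hY : Y ⊆ E(G)) {e : β}
    (he : e ∈ E(G)) (heY : e ∉ Y) {t : unitInterval} (ht : t ∈ Ioo 0 1) :
    D.curve e t ∉ D.drawing X Y := by
  rw [mem_drawing]
  rintro (⟨v, hv, h⟩ | ⟨f, hf, s, h⟩)
  · exact D.curve_ne_point e he v (hX hv) t ht h.symm
  · rcases D.curve_eq_point_or_mem_Ioo (hY hf) s with ⟨v, hv, h'⟩ | hs
    · exact D.curve_ne_point e he v hv.vertex_mem t ht (h ▸ h')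
    · exact D.curve_disjoint e he f (hY hf) (fun h ↦ heY (h ▸ hf)) t ht s hs h.symm

lemma isPreconnected_image_Ioo {e : β} (he : e ∈ E(G)) :
    IsPreconnected (D.curve e '' Ioo 0 1) :=
  isPreconnected_Ioo.image _ (D.continuous_curve e he).continuousOn

lemma curve_mem_closure {e : β} (he : e ∈ E(G)) (t : unitInterval) :
    D.curve e t ∈ closure (D.curve e '' Ioo 0 1) := by
  refine image_closure_subset_closure_image (D.continuous_curve e he) (mem_image_of_mem _ ?_)
  rw [closure_Ioo zero_ne_one]
  exact ⟨unitInterval.nonneg', unitInterval.le_one'⟩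

namespace IsFace

variable {D}

lemma disjoint_support (hF : D.IsFace F) : Disjoint F D.support := by
  obtain ⟨z, -, rfl⟩ := hF
  exact disjoint_left.2 fun x hx ↦ connectedComponentIn_subset _ _ hx

lemma nonempty (hF : D.IsFace F) : F.Nonempty := by
  obtain ⟨z, hz, rfl⟩ := hF
  exact ⟨z, mem_connectedComponentIn hz⟩

lemma isPreconnected (hF : D.IsFace F) : IsPreconnected F := by
  obtain ⟨z, -, rfl⟩ := hF
  exact isPreconnected_connectedComponentIn

lemma frontier_subset (hF : D.IsFace F) (hV : V(G).Finite) (hE : E(G).Finite) :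
    frontier F ⊆ D.support := by
  obtain ⟨z, -, rfl⟩ := hF
  exact frontier_component_subset (D.isCompact_support hV hE).isClosed z

lemma frontier_nonempty (hF : D.IsFace F) (hne : V(G).Nonempty) : (frontier F).Nonempty := by
  rw [nonempty_frontier_iff]
  refine ⟨hF.nonempty, fun h ↦ ?_⟩
  obtain ⟨v, hv⟩ := hne
  exact disjoint_left.1 hF.disjoint_support (h ▸ mem_univ (D.point v))
    (mem_support.2 (.inl ⟨v, hv, rfl⟩))

/-- A boundary point of a face stays connected with the face when the drawing near it is erased. -/
lemma mem_component_of_mem_frontier (hF : D.IsFace F) {K : Set ℂ} (hK : IsClosed K)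
    (hKD : K ⊆ D.support) {z x : ℂ} (hz : z ∈ F) (hx : x ∈ frontier F) (hxK : x ∉ K) :
    x ∈ connectedComponentIn Kᶜ z := by
  refine mem_component_of_mem_closure hK hxK (closure_mono ?_ hx.1)
  exact hF.isPreconnected.subset_connectedComponentIn hz fun y hy hyK ↦
    disjoint_left.1 hF.disjoint_support hy (hKD hyK)

/-- If an inner point of an edge is on the boundary of a face, then the whole edge is. -/
lemma isBoundaryEdge_of_mem (hF : D.IsFace F) (hV : V(G).Finite) (hE : E(G).Finite) {e : β}
    (he : e ∈ E(G)) {t : unitInterval} (ht : t ∈ Ioo 0 1) (htF : D.curve e t ∈ frontier F) :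
    D.IsBoundaryEdge F e := by
  have hc := D.continuous_curve e he
  suffices h : D.curve e '' Ioo 0 1 ⊆ frontier F by
    refine ⟨he, ?_⟩
    rintro _ ⟨s, rfl⟩
    exact closure_minimal h isClosed_frontier (D.curve_mem_closure he s)
  rintro _ ⟨s, hs, rfl⟩
  by_contra hsF
  have hnF : ∀ r, D.curve e r ∉ F := fun r hr ↦
    disjoint_left.1 hF.disjoint_support hr (D.curve_mem_support he r)
  -- The frontier misses the piece of `e` between `l` and `u`. Erase `e`, so that `F` reaches the
  -- point at `s` along `e`, then put back the two end pieces, each meeting what is already there in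
  -- at most one point. The result contains the frontier of `F` and still does not separate `s` from
  -- `F`.
  obtain ⟨l, u, hlu, hsub⟩ := (mem_nhds_iff_exists_Ioo_subset' ⟨0, hs.1⟩ ⟨1, hs.2⟩).1
    ((isClosed_frontier.isOpen_compl.preimage hc).mem_nhds hsF)
  have hl1 : l < 1 := hlu.1.trans hs.2
  have hu0 : 0 < u := hs.1.trans hlu.2
  set K := D.drawing V(G) (E(G) \ {e}) with hKdef
  have hK : IsCompact K := D.isCompact_drawing hV hE.sdiff sdiff_subset
  have hKD : K ⊆ D.support := D.drawing_subset_support Subset.rfl sdiff_subset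
  have hnK : ∀ r ∈ Ioo 0 1, D.curve e r ∉ K := fun r hr ↦
    D.curve_notMem_drawing Subset.rfl sdiff_subset he (by simp) hr
  obtain ⟨z, hz⟩ := hF.nonempty
  have hzt := hF.mem_component_of_mem_frontier hK.isClosed hKD hz htF (hnK t ht)
  have hzs : D.curve e s ∈ connectedComponentIn Kᶜ z := by
    rw [connectedComponentIn_eq hzt]
    refine (D.isPreconnected_image_Ioo he).subset_connectedComponentIn
      (mem_image_of_mem _ ht) ?_ (mem_image_of_mem _ hs)
    rintro _ ⟨r, hr, rfl⟩
    exact hnK r hr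
  have hzc : ∀ I : Set unitInterval, z ∉ D.curve e '' I := by
    rintro I ⟨r, -, rfl⟩
    exact hnF r hz
  have hsc : ∀ r, D.curve e s = D.curve e r → r = s := by
    intro r h
    rcases D.curve_simple e he s r h with h | h | h
    · exact h.symm
    · exact absurd h.1 hs.1.ne'
    · exact absurd h.1 hs.2.ne
  have hz1 : D.curve e s ∈ connectedComponentIn (K ∪ D.curve e '' Icc 0 l)ᶜ z := by
    refine mem_component_union_arc hK hc unitInterval.nonneg' ?_ ?_ (hzc _) ?_ hzs
    · intro r hr r' hr' h
      rcases D.curve_simple e he r r' h with h | h | h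
      · exact h
      · exact absurd h.2 (hr'.2.trans_lt hl1).ne
      · exact absurd h.1 (hr.2.trans_lt hl1).ne
    · have : K ∩ D.curve e '' Icc 0 l ⊆ {D.curve e 0} := by
        rintro _ ⟨hrK, r, hr, rfl⟩
        rcases eq_zero_or_eq_one_or_mem_Ioo r with rfl | rfl | h
        · rfl
        · exact absurd hr.2 hl1.not_ge
        · exact absurd hrK (hnK r h)
      exact subsingleton_singleton.anti this
    · rintro ⟨r, hr, h⟩
      rw [hsc r h.symm] at hr
      exact hr.2.not_gt hlu.1
  have hz2 : D.curve e s ∈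
      connectedComponentIn (K ∪ D.curve e '' Icc 0 l ∪ D.curve e '' Icc u 1)ᶜ z := by
    refine mem_component_union_arc (hK.union (isCompact_Icc.image hc)) hc unitInterval.le_one'
      ?_ ?_ (hzc _) ?_ hz1
    · intro r hr r' hr' h
      rcases D.curve_simple e he r r' h with h | h | h
      · exact h
      · exact absurd h.1 (hu0.trans_le hr.1).ne'
      · exact absurd h.2 (hu0.trans_le hr'.1).ne'
    · have : (K ∪ D.curve e '' Icc 0 l) ∩ D.curve e '' Icc u 1 ⊆ {D.curve e 1} := by
        rintro _ ⟨hrK, r, hr, rfl⟩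
        rcases eq_zero_or_eq_one_or_mem_Ioo r with rfl | rfl | h
        · exact absurd hr.1 hu0.not_ge
        · rfl
        rcases hrK with hrK | ⟨r', hr', h'⟩
        · exact absurd hrK (hnK r h)
        rcases D.curve_simple e he r' r h' with h' | h' | h'
        · exact absurd (hr.1.trans (h' ▸ hr'.2)) (hlu.1.trans hlu.2).not_ge
        · exact absurd h'.2 h.2.ne
        · exact absurd h'.2 h.1.ne'
      exact subsingleton_singleton.anti this
    · rintro ⟨r, hr, h⟩
      rw [hsc r h.symm] at hr
      exact hr.1.not_gt hlu.2
  refine hnF s (mem_of_mem_component_of_frontier_subset ?_ hz hz2)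
  intro x hx
  rcases mem_support.1 (hF.frontier_subset hV hE hx) with ⟨v, hv, rfl⟩ | ⟨f, hf, r, rfl⟩
  · exact .inl (.inl (mem_drawing.2 (.inl ⟨v, hv, rfl⟩)))
  by_cases hfe : f = e
  · subst hfe
    rcases le_or_gt r l with h | h
    · exact .inl (.inr ⟨r, ⟨unitInterval.nonneg', h⟩, rfl⟩)
    rcases le_or_gt u r with h' | h'
    · exact .inr ⟨r, ⟨h', unitInterval.le_one'⟩, rfl⟩
    · exact absurd hx (hsub ⟨h, h'⟩)
  · exact .inl (.inl (mem_drawing.2 (.inr ⟨f, ⟨hf, hfe⟩, r, rfl⟩)))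

/-- The boundary of a face does not end at a vertex of degree at least two. -/
lemma exists_isBoundaryEdge_inc (hF : D.IsFace F) (hV : V(G).Finite) (hE : E(G).Finite) {e p : β}
    {a : α} (hea : G.IsNonloopAt e a) (hpa : G.Inc p a) (hpe : p ≠ e)
    (haF : D.point a ∈ frontier F) : ∃ q, q ≠ e ∧ G.Inc q a ∧ D.IsBoundaryEdge F q := by
  by_contra! hno
  obtain ⟨b, hba, hab⟩ := hea
  have he := hab.edge_mem
  have hp := hpa.edge_mem
  have hc := D.continuous_curve e he
  -- With `a` and all edges at `a` erased, `F` is connected through `a` to the inside of `p`.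
  set K := D.drawing (V(G) \ {a}) {f ∈ E(G) | ¬ G.Inc f a} with hKdef
  have hYE : {f ∈ E(G) | ¬ G.Inc f a} ⊆ E(G) := fun f hf ↦ hf.1
  have hK : IsCompact K := D.isCompact_drawing hV.sdiff (hE.subset hYE) hYE
  have hKD : K ⊆ D.support := D.drawing_subset_support sdiff_subset hYE
  have haK : D.point a ∉ K := by
    rw [hKdef, mem_drawing]
    rintro (⟨v, hv, h⟩ | ⟨f, hf, t, h⟩)
    · exact hv.2 (D.point_injOn hv.1 hab.left_mem h)
    · rcases D.curve_eq_point_or_mem_Ioo hf.1 t with ⟨v, hv, h'⟩ | ht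
      · exact hf.2 (D.point_injOn hv.vertex_mem hab.left_mem (h'.symm.trans h) ▸ hv)
      · exact D.curve_ne_point f hf.1 a hab.left_mem t ht h
  have hnK : ∀ {f}, G.Inc f a → ∀ r ∈ Ioo 0 1, D.curve f r ∉ K := fun {f} hf r hr ↦
    D.curve_notMem_drawing sdiff_subset hYE hf.edge_mem (fun h ↦ h.2 hf) hr
  obtain ⟨z, hz⟩ := hF.nonempty
  have hnF : ∀ {f}, f ∈ E(G) → ∀ r, D.curve f r ∉ F := fun hf r hr ↦
    disjoint_left.1 hF.disjoint_support hr (D.curve_mem_support hf r)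
  obtain ⟨s, hs⟩ : (Ioo (0 : unitInterval) 1).Nonempty := nonempty_Ioo.2 zero_lt_one
  have hza := hF.mem_component_of_mem_frontier hK.isClosed hKD hz haF haK
  have hpa' : D.point a ∈ connectedComponentIn Kᶜ (D.curve p s) := by
    refine mem_component_of_mem_closure hK.isClosed haK (closure_mono
      ((D.isPreconnected_image_Ioo hp).subset_connectedComponentIn (mem_image_of_mem _ hs) ?_) ?_)
    · rintro _ ⟨r, hr, rfl⟩
      exact hnK hpa r hr
    · rcases D.exists_curve_eq_point hpa with h | h <;> rw [← h] <;> exact D.curve_mem_closure hp _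
  have hzp : D.curve p s ∈ connectedComponentIn Kᶜ z := by
    rw [connectedComponentIn_eq hza, ← connectedComponentIn_eq hpa']
    exact mem_connectedComponentIn (hnK hpa s hs)
  have hpe' : ∀ r, D.curve e r ≠ D.curve p s := by
    intro r h
    refine D.curve_notMem_drawing (X := ∅) (Y := {e}) (empty_subset _)
      (singleton_subset_iff.2 he) hp hpe hs ?_
    exact mem_drawing.2 (.inr ⟨e, rfl, r, h⟩)
  obtain ⟨x, y, hxy, h0, h1⟩ := D.curve_ends e he
  have hxyne : x ≠ y := by
    rintro rfl
    exact hba ((hab.right_eq_or_eq hxy).elim id id |>.trans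
      ((hab.left_eq_or_eq hxy).elim id id).symm)
  have hne01 : D.curve e 0 ≠ D.curve e 1 := by
    rw [h0, h1]
    exact fun h ↦ hxyne (D.point_injOn hxy.left_mem hxy.right_mem h)
  -- Putting back `e` alone, which meets `K` at most in `b`, does not cut `p` off from `F`. Yet `K`
  -- and `e` cover the frontier of `F`, as the other edges at `a` have no inner points on it. So `F`
  -- would contain a point of `p`.
  have hmem := mem_component_union_arc hK hc (s := 0) (t := 1) zero_le_one ?_ ?_ ?_ ?_ hzp
  · refine hnF hp s (mem_of_mem_component_of_frontier_subset ?_ hz hmem)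
    have hvert : ∀ v ∈ V(G), D.point v ∈ K ∪ D.curve e '' Icc 0 1 := by
      intro v hv
      by_cases hva : v = a
      · subst hva
        rcases D.exists_curve_eq_point hab.inc_left with h | h
        · exact .inr ⟨0, by simp, h⟩
        · exact .inr ⟨1, by simp, h⟩
      · exact .inl (mem_drawing.2 (.inl ⟨v, ⟨hv, hva⟩, rfl⟩))
    intro x hx
    rcases mem_support.1 (hF.frontier_subset hV hE hx) with ⟨v, hv, rfl⟩ | ⟨f, hf, r, rfl⟩
    · exact hvert v hv
    by_cases hfe : f = e
    · subst hfe
      exact .inr ⟨r, ⟨unitInterval.nonneg', unitInterval.le_one'⟩, rfl⟩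
    by_cases hfa : G.Inc f a
    · rcases D.curve_eq_point_or_mem_Ioo hf r with ⟨v, hv, h⟩ | hr
      · exact h ▸ hvert v hv.vertex_mem
      · exact absurd (hF.isBoundaryEdge_of_mem hV hE hf hr hx) (hno f hfe hfa)
    · exact .inl (mem_drawing.2 (.inr ⟨f, ⟨hf, hfa⟩, r, rfl⟩))
  · intro r _ r' _ h
    rcases D.curve_simple e he r r' h with h' | ⟨rfl, rfl⟩ | ⟨rfl, rfl⟩
    · exact h'
    · exact absurd h hne01
    · exact absurd h.symm hne01
  · have : K ∩ D.curve e '' Icc 0 1 ⊆ {D.point b} := by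
      rintro _ ⟨hrK, r, -, rfl⟩
      rcases D.curve_eq_point_or_mem_Ioo he r with ⟨v, hv, h⟩ | hr
      · rcases hv.eq_or_eq_of_isLink hab with rfl | rfl
        · exact absurd (h ▸ hrK) haK
        · exact h
      · exact absurd hrK (hnK hab.inc_left r hr)
    exact subsingleton_singleton.anti this
  · rintro ⟨r, -, rfl⟩
    exact hnF he r hz
  · rintro ⟨r, -, h⟩
    exact hpe' r h

/-- If every vertex lies on two edges one of which is not a loop, then every face has an edge on
its boundary. -/
lemma exists_isBoundaryEdge (hF : D.IsFace F) (hV : V(G).Finite) (hE : E(G).Finite)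
    (hne : V(G).Nonempty)
    (hdeg : ∀ v ∈ V(G), ∃ e p, G.IsNonloopAt e v ∧ G.Inc p v ∧ p ≠ e) :
    ∃ e, D.IsBoundaryEdge F e := by
  have hvert : ∀ v ∈ V(G), D.point v ∈ frontier F → ∃ e, D.IsBoundaryEdge F e := by
    intro v hv hvF
    obtain ⟨e, p, he, hp, hpe⟩ := hdeg v hv
    obtain ⟨q, -, -, hq⟩ := hF.exists_isBoundaryEdge_inc hV hE he hp hpe hvF
    exact ⟨q, hq⟩
  obtain ⟨x, hx⟩ := hF.frontier_nonempty hne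
  rcases mem_support.1 (hF.frontier_subset hV hE hx) with ⟨v, hv, rfl⟩ | ⟨f, hf, r, rfl⟩
  · exact hvert v hv hx
  rcases D.curve_eq_point_or_mem_Ioo hf r with ⟨v, hv, h⟩ | hr
  · exact hvert v hv.vertex_mem (h ▸ hx)
  · exact ⟨f, hF.isBoundaryEdge_of_mem hV hE hf hr hx⟩

end IsFace

variable {D} in
lemma IsBoundaryEdge.point_mem_frontier {e : β} (he : D.IsBoundaryEdge F e) {v : α}
    (hv : G.Inc e v) : D.point v ∈ frontier F := by
  rcases D.exists_curve_eq_point hv with h | h <;> exact h ▸ he.2 (mem_range_self _)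

end Graph.PlaneEmbedding

/-! ### Edge cuts and the uncrossing argument. -/

namespace Graph

open Set

variable {α β : Type*} {G H : Graph α β} {e f : β} {X A C : Set α} {x y v w : α}

/-- The edges with exactly one end in `X`. -/
def cut (G : Graph α β) (X : Set α) : Set β :=
  {e | ∃ x y, G.IsLink e x y ∧ x ∈ X ∧ y ∉ X}

lemma IsLink.mem_cut_iff (h : G.IsLink e x y) : e ∈ G.cut X ↔ ¬ (x ∈ X ↔ y ∈ X) := by
  constructor
  · rintro ⟨u, v, h', hu, hv⟩
    rcases h.eq_and_eq_or_eq_and_eq h' with ⟨rfl, rfl⟩ | ⟨rfl, rfl⟩ <;> tauto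
  · intro hxy
    by_cases hx : x ∈ X
    · exact ⟨x, y, h, hx, by tauto⟩
    · exact ⟨y, x, h.symm, by tauto, hx⟩

lemma cut_subset_edgeSet : G.cut X ⊆ E(G) := fun _ ⟨_, _, h, _⟩ ↦ h.edge_mem

lemma cut_compl (G : Graph α β) (X : Set α) : G.cut Xᶜ = G.cut X := by
  ext e
  by_cases he : e ∈ E(G)
  · obtain ⟨x, y, h⟩ := exists_isLink_of_mem_edgeSet he
    rw [h.mem_cut_iff, h.mem_cut_iff, mem_compl_iff, mem_compl_iff]
    tauto
  · exact ⟨fun h ↦ (he (cut_subset_edgeSet h)).elim, fun h ↦ (he (cut_subset_edgeSet h)).elim⟩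

lemma cut_inter_vertexSet (G : Graph α β) (X : Set α) : G.cut (X ∩ V(G)) = G.cut X := by
  ext e
  by_cases he : e ∈ E(G)
  · obtain ⟨x, y, h⟩ := exists_isLink_of_mem_edgeSet he
    simp [h.mem_cut_iff, h.left_mem, h.right_mem]
  · exact ⟨fun h ↦ (he (cut_subset_edgeSet h)).elim, fun h ↦ (he (cut_subset_edgeSet h)).elim⟩

lemma cut_singleton (G : Graph α β) (v : α) : G.cut {v} = {e | G.IsNonloopAt e v} := by
  ext e
  constructor
  · rintro ⟨x, y, h, rfl, hy⟩
    exact ⟨y, hy, h⟩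
  · rintro ⟨y, hy, h⟩
    exact ⟨v, y, h, rfl, hy⟩

lemma cut_deleteEdges (G : Graph α β) (Y : Set β) (X : Set α) :
    (G.deleteEdges Y).cut X = G.cut X \ Y := by
  ext e
  simp only [cut, deleteEdges_isLink, mem_ofPred_eq, mem_sdiff]
  grind

/-- The cut function is submodular. -/
lemma ncard_cut_inter_add_ncard_cut_union_le (hE : E(G).Finite) (A C : Set α) :
    (G.cut (A ∩ C)).ncard + (G.cut (A ∪ C)).ncard ≤ (G.cut A).ncard + (G.cut C).ncard := by
  have hfin : ∀ X, (G.cut X).Finite := fun X ↦ hE.subset cut_subset_edgeSet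
  -- Each sum is the size of the union plus that of the intersection, and these are compared by
  -- inclusion.
  rw [← ncard_union_add_ncard_inter _ _ (hfin _) (hfin _),
    ← ncard_union_add_ncard_inter (G.cut A) _ (hfin _) (hfin _)]
  refine add_le_add (ncard_le_ncard ?_ ((hfin _).union (hfin _)))
    (ncard_le_ncard ?_ ((hfin _).inter_of_left _))
  · rintro e he
    obtain ⟨x, y, h⟩ := exists_isLink_of_mem_edgeSet
      (he.elim (fun h ↦ cut_subset_edgeSet h) fun h ↦ cut_subset_edgeSet h)
    simp only [mem_union, mem_inter_iff, h.mem_cut_iff] at he ⊢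
    tauto
  · rintro e ⟨he, he'⟩
    obtain ⟨x, y, h⟩ := exists_isLink_of_mem_edgeSet (cut_subset_edgeSet he)
    simp only [mem_union, mem_inter_iff, h.mem_cut_iff] at he he' ⊢
    tauto

lemma Joined.map {r : α → α} (h : G.Joined x y)
    (hr : ∀ a b, G.Adj a b → H.Joined (r a) (r b)) : H.Joined (r x) (r y) :=
  Relation.ReflTransGen.lift' r hr _ _ h

lemma Joined.symm (h : G.Joined x y) : G.Joined y x :=
  Relation.ReflTransGen.stdSymm.symm _ _ h

lemma Joined.mem_of_cut_eq_empty (h : G.Joined x y) (hX : G.cut X = ∅) (hx : x ∈ X) : y ∈ X := by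
  induction h with
  | refl => exact hx
  | tail _ hbc ih =>
    obtain ⟨e, he⟩ := hbc
    by_contra hc
    exact hX.subset ⟨_, _, he, ih, hc⟩

lemma IsBridgeless.cut_ne_singleton (hG : G.IsBridgeless) (X : Set α) (e : β) :
    G.cut X ≠ {e} := by
  intro h
  obtain ⟨x, y, hxy, hx, hy⟩ : e ∈ G.cut X := h ▸ mem_singleton e
  refine hG e ⟨x, y, hxy, fun hj ↦ hy (hj.mem_of_cut_eq_empty ?_ hx)⟩
  rw [cut_deleteEdges, h, sdiff_self]

lemma IsBridgeless.ncard_cut_ne_one (hG : G.IsBridgeless) (X : Set α) : (G.cut X).ncard ≠ 1 := by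
  rw [Ne, ncard_eq_one]
  rintro ⟨e, he⟩
  exact hG.cut_ne_singleton X e he

/-- If deleting `e` creates a bridge, then `e` is in a cut with two edges. -/
lemma IsBridgeless.exists_cut_eq_pair (hG : G.IsBridgeless)
    (he : ¬ (G.deleteEdges {e}).IsBridgeless) : ∃ X, e ∈ G.cut X ∧ (G.cut X).ncard = 2 := by
  simp only [IsBridgeless, not_forall, not_not] at he
  obtain ⟨f, x, y, hxy, hj⟩ := he
  rw [deleteEdges_isLink] at hxy
  rw [deleteEdges_deleteEdges] at hj
  -- The component of `x` in `G - e - f`. Only `e` and `f` can leave it; if `e` did not, `f` would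
  -- be a bridge of `G`.
  set X : Set α := {z | (G.deleteEdges ({e} ∪ {f})).Joined x z} with hX
  have hfX : f ∈ G.cut X := ⟨x, y, hxy.1, Relation.ReflTransGen.refl, hj⟩
  have hsub : G.cut X ⊆ {e, f} := by
    rintro h ⟨u, v, huv, hu, hv⟩
    by_contra hne
    exact hv (Relation.ReflTransGen.tail hu ⟨h, by simpa [huv, and_comm] using hne⟩)
  have heX : e ∈ G.cut X := by
    by_contra h
    refine hG.cut_ne_singleton X f (Subset.antisymm (fun g hg ↦ ?_) (singleton_subset_iff.2 hfX))
    rcases hsub hg with rfl | hg'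
    · exact (h hg).elim
    · exact hg'
  refine ⟨X, heX, ?_⟩
  rw [hsub.antisymm (by rintro g (rfl | rfl) <;> assumption),
    ncard_pair (Ne.symm (by simpa using hxy.2))]

/-- A loop uses two of the three degrees, so the remaining edge at `v` would be a bridge. -/
lemma IsBridgeless.not_isLoopAt (hG : G.IsBridgeless) (hv : G.eDegree v = 3) :
    ¬ G.IsLoopAt e v := by
  intro he
  rw [eDegree, ← cut_singleton] at hv
  have h1 : 1 ≤ {e | G.IsLoopAt e v}.encard := one_le_encard_iff_nonempty.2 ⟨e, he⟩
  have hN : (G.cut {v}).encard ≠ ⊤ := fun h ↦ by simp [h] at hv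
  have hL : {e | G.IsLoopAt e v}.encard ≠ ⊤ := fun h ↦ by simp [h] at hv
  have h2 : (G.cut {v}).encard = 1 := by
    revert hv h1
    lift {e | G.IsLoopAt e v}.encard to ℕ using hL with l
    lift (G.cut {v}).encard to ℕ using hN with n
    intro hv h1
    norm_cast at hv h1 ⊢
    omega
  obtain ⟨f, hf⟩ := encard_eq_one.1 h2
  exact hG.cut_ne_singleton _ _ hf

lemma IsBridgeless.encard_cut_singleton (hG : G.IsBridgeless) (hv : G.eDegree v = 3) :
    (G.cut {v}).encard = 3 := by
  have : {e | G.IsLoopAt e v} = ∅ := eq_empty_of_forall_notMem fun e ↦ hG.not_isLoopAt hv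
  rwa [eDegree, this, encard_empty, mul_zero, add_zero, ← cut_singleton] at hv

lemma IsBridgeless.exists_three_edges (hG : G.IsBridgeless) (hv : G.eDegree v = 3) :
    ∃ e f g, e ≠ f ∧ e ≠ g ∧ f ≠ g ∧ G.cut {v} = {e, f, g} := by
  obtain ⟨e, f, g, h⟩ := encard_eq_three.1 (hG.encard_cut_singleton hv)
  exact ⟨e, f, g, h⟩

/-- A nonempty set of edges that never ends at a vertex contains an edge outside of all cuts with
two edges. -/
lemma IsBridgeless.exists_deleteEdges_isBridgeless (hG : G.IsBridgeless) (hcubic : G.IsCubic)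
    (hV : V(G).Finite) (hE : E(G).Finite) {P : β → Prop}
    (hne : ∃ e, P e) (hstep : ∀ e a, P e → G.Inc e a → ∃ q, q ≠ e ∧ G.Inc q a ∧ P q) :
    ∃ e, P e ∧ (G.deleteEdges {e}).IsBridgeless := by
  by_contra! hno
  have hcut : ∀ e, P e → ∃ X, e ∈ G.cut X ∧ (G.cut X).ncard = 2 :=
    fun e he ↦ hG.exists_cut_eq_pair (hno e he)
  let S : Set (Set α) := {A | A ⊆ V(G) ∧ (G.cut A).ncard = 2 ∧ ∃ e ∈ G.cut A, P e}
  have hS : S.Finite := hV.finite_subsets.subset fun A hA ↦ hA.1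
  have hSne : S.Nonempty := by
    obtain ⟨e, he⟩ := hne
    obtain ⟨X, heX, hX⟩ := hcut e he
    exact ⟨X ∩ V(G), inter_subset_right, by rwa [cut_inter_vertexSet],
      e, by rwa [cut_inter_vertexSet], he⟩
  obtain ⟨A, ⟨hAV, hA2, e, heA, he⟩, hmin⟩ := hS.exists_minimal hSne
  obtain ⟨a, b, hab, ha, hb⟩ := id heA
  obtain ⟨p, hpe, ⟨c, hpc⟩, hp⟩ := hstep e a he hab.inc_left
  have hloop : ∀ {f}, ¬ G.IsLoopAt f a := hG.not_isLoopAt (hcubic a hab.left_mem)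
  have hca : c ≠ a := by
    rintro rfl
    exact hloop hpc
  have hba : b ≠ a := by
    rintro rfl
    exact hb ha
  -- Otherwise `e` and `p` form the whole cut of `A`, and moving `a` across leaves only the third
  -- edge at `a`, a bridge.
  have hc : c ∈ A := by
    by_contra hcA
    have hpA : p ∈ G.cut A := ⟨a, c, hpc, ha, hcA⟩
    have hA : G.cut A = {e, p} := by
      refine (eq_of_subset_of_ncard_le ?_ ?_ (hE.subset cut_subset_edgeSet)).symm
      · rintro g (rfl | rfl) <;> assumption
      · rw [hA2, ncard_pair hpe.symm]
    have h1 : ((G.cut {a}) \ {e, p}).encard = 1 := by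
      have := encard_sdiff_add_encard_of_subset (s := {e, p}) (t := G.cut {a}) (by
        rintro g (rfl | rfl)
        · exact ⟨a, b, hab, rfl, hba⟩
        · exact ⟨a, c, hpc, rfl, hca⟩)
      rw [hG.encard_cut_singleton (hcubic a hab.left_mem), encard_pair hpe.symm] at this
      have hfin : ((G.cut {a}) \ {e, p}).encard ≠ ⊤ := fun h ↦ by simp [h] at this
      revert this
      lift ((G.cut {a}) \ {e, p}).encard to ℕ using hfin with n
      intro this
      norm_cast at this ⊢
      omega
    refine hG.ncard_cut_ne_one (A \ {a}) ?_
    suffices h : G.cut (A \ {a}) = G.cut {a} \ {e, p} by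
      rw [h, ncard, h1]
      rfl
    ext g
    by_cases hg : g ∈ E(G)
    swap
    · exact ⟨fun h ↦ (hg (cut_subset_edgeSet h)).elim, fun h ↦ (hg (cut_subset_edgeSet h.1)).elim⟩
    obtain ⟨x, y, hxy⟩ := exists_isLink_of_mem_edgeSet hg
    have hgA : g = e ∨ g = p ↔ ¬ (x ∈ A ↔ y ∈ A) := by
      rw [← hxy.mem_cut_iff, hA]
      rfl
    have hxya : ¬ (x = a ∧ y = a) := by
      rintro ⟨rfl, rfl⟩
      exact hloop hxy
    have hga : ¬ (x ∈ A ↔ y ∈ A) → a = x ∨ a = y := fun h ↦ by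
      rcases hgA.2 h with rfl | rfl
      · exact hab.left_eq_or_eq hxy
      · exact hpc.left_eq_or_eq hxy
    simp only [mem_sdiff, hxy.mem_cut_iff, mem_insert_iff, mem_singleton_iff, hgA]
    clear * - hga hxya ha
    by_cases hx : x = a <;> by_cases hy : y = a <;> simp_all
    tauto
  obtain ⟨C, hpC, hC2⟩ := hcut p hp
  -- Both cuts on the left of submodularity would have at least two edges, hence exactly two. Then
  -- `A ∩ D` is in `S`, and minimality gives `A ⊆ D`, although `p` lies in `A` and crosses `D`.
  have hAC : ∀ D : Set α, p ∈ G.cut D → (G.cut D).ncard = 2 → (G.cut (A ∪ D)).ncard = 0 := by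
    intro D hpD hD2
    by_contra hU
    rw [hpc.mem_cut_iff] at hpD
    have hpAD : p ∈ G.cut (A ∩ D) := by
      rw [hpc.mem_cut_iff]
      simpa [ha, hc] using hpD
    have h0 : (G.cut (A ∩ D)).ncard ≠ 0 :=
      ncard_ne_zero_of_mem hpAD (hE.subset cut_subset_edgeSet)
    have h1 := hG.ncard_cut_ne_one (A ∩ D)
    have h2 := hG.ncard_cut_ne_one (A ∪ D)
    have h3 := ncard_cut_inter_add_ncard_cut_union_le hE A D
    have hmem : A ∩ D ∈ S := ⟨inter_subset_left.trans hAV, by omega, p, hpAD, hp⟩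
    have := hmin hmem inter_subset_left
    exact hpD ⟨fun _ ↦ (this hc).2, fun _ ↦ (this ha).2⟩
  -- The end `b ∉ A` of `e` is missing from one of `A ∪ C` and `A ∪ Cᶜ`, so `e` crosses that one.
  have h1 := hAC C hpC hC2
  have h2 := hAC Cᶜ (by rwa [cut_compl]) (by rwa [cut_compl])
  rw [ncard_eq_zero (hE.subset cut_subset_edgeSet)] at h1 h2
  have h1' : e ∉ G.cut (A ∪ C) := h1 ▸ notMem_empty e
  have h2' : e ∉ G.cut (A ∪ Cᶜ) := h2 ▸ notMem_empty e
  rw [hab.mem_cut_iff] at h1' h2'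
  simp only [mem_union, ha, hb, mem_compl_iff, true_or, false_or, true_iff, not_not] at h1' h2'
  exact h2' h1'

end Graph

/-! ### Smoothing vertices of degree two. -/

namespace Graph

open Set

variable {α β : Type*} {G H : Graph α β} {e f g : β} {u v w x y : α}

/-- Replace the vertex `w` and the edges at `w` by the edge `f`, now from `x` to `y`. -/
def smooth (H : Graph α β) (w : α) (f : β) (x y : α) (hf : H.Inc f w) (hx : x ∈ V(H) \ {w})
    (hy : y ∈ V(H) \ {w}) : Graph α β where
  vertexSet := V(H) \ {w}
  IsLink h a b := (H.IsLink h a b ∧ a ≠ w ∧ b ≠ w) ∨ (h = f ∧ s(a, b) = s(x, y))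
  isLink_symm h _ := ⟨fun a b hab ↦ by
    rw [H.isLink_comm, Sym2.eq_swap]
    tauto⟩
  eq_or_eq_of_isLink_of_isLink := by
    -- The old edge `f` ends at `w` and disappears, so its name is free for the new edge.
    have key : ∀ {a b}, H.IsLink f a b → a ≠ w → b ≠ w → False := fun hab ha hb ↦
      (hf.eq_or_eq_of_isLink hab).elim (ha ·.symm) (hb ·.symm)
    rintro h a b c d (⟨h₁, ha, hb⟩ | ⟨h₀, h₁⟩) (⟨h₂, hc, hd⟩ | ⟨h₀', h₂⟩)
    · exact h₁.left_eq_or_eq h₂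
    · exact (key (h₀' ▸ h₁) ha hb).elim
    · exact (key (h₀ ▸ h₂) hc hd).elim
    · rw [← h₂, Sym2.eq_iff] at h₁
      tauto
  left_mem_of_isLink := by
    rintro h a b (⟨h₁, ha, -⟩ | ⟨rfl, h₁⟩)
    · exact ⟨h₁.left_mem, ha⟩
    · rw [Sym2.eq_iff] at h₁
      rcases h₁ with ⟨rfl, -⟩ | ⟨rfl, -⟩ <;> assumption

lemma IsLoopAt.isLink_iff_eq_and_eq (h : G.IsLoopAt e w) : G.IsLink e x y ↔ x = w ∧ y = w := by
  rw [← isLink_self_iff] at h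
  rw [h.isLink_iff]
  tauto

lemma eDegree_eq_two (h : H.eDegree w = 2) :
    (∃ f g, f ≠ g ∧ H.IsNonloopAt f w ∧ H.IsNonloopAt g w ∧ ∀ h, H.Inc h w → h = f ∨ h = g) ∨
      ∃ f, H.IsLoopAt f w ∧ ∀ h, H.Inc h w → h = f := by
  rw [eDegree] at h
  have hN : {e | H.IsNonloopAt e w}.encard ≠ ⊤ := fun h' ↦ by simp [h'] at h
  have hL : {e | H.IsLoopAt e w}.encard ≠ ⊤ := fun h' ↦ by simp [h'] at h
  have key : ({e | H.IsNonloopAt e w}.encard = 2 ∧ {e | H.IsLoopAt e w}.encard = 0) ∨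
      ({e | H.IsNonloopAt e w}.encard = 0 ∧ {e | H.IsLoopAt e w}.encard = 1) := by
    revert h
    lift {e | H.IsNonloopAt e w}.encard to ℕ using hN with n
    lift {e | H.IsLoopAt e w}.encard to ℕ using hL with l
    intro h
    norm_cast at h ⊢
    omega
  simp only [encard_eq_zero, encard_eq_two, encard_eq_one] at key
  rcases key with ⟨⟨f, g, hfg, hN⟩, hL⟩ | ⟨hN, f, hL⟩
  · refine .inl ⟨f, g, hfg, hN.superset (by simp), hN.superset (by simp), fun h hh ↦ ?_⟩
    rcases hh.isLoopAt_or_isNonloopAt with hh | hh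
    · exact (hL.subset hh).elim
    · exact hN.subset hh
  · refine .inr ⟨f, hL.superset rfl, fun h hh ↦ ?_⟩
    rcases hh.isLoopAt_or_isNonloopAt with hh | hh
    · exact hL.subset hh
    · exact (hN.subset hh).elim

lemma encard_congr_swap {N N' : Set β} (hf : f ∉ N) (hg : g ∈ N)
    (h : ∀ e, e ∈ N' ↔ e = f ∨ (e ∈ N ∧ e ≠ g)) : N'.encard = N.encard := by
  have : N' = insert f (N \ {g}) := by
    ext e
    rw [h]
    rfl
  rw [this, encard_insert_of_notMem (fun h ↦ hf h.1), ← encard_sdiff_singleton_add_one hg]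

section Smooth

variable {hf : H.Inc f w} {hx : x ∈ V(H) \ {w}} {hy : y ∈ V(H) \ {w}}

lemma smooth_isLink {h : β} {a b : α} : (H.smooth w f x y hf hx hy).IsLink h a b ↔
    (H.IsLink h a b ∧ a ≠ w ∧ b ≠ w) ∨ (h = f ∧ s(a, b) = s(x, y)) := Iff.rfl

/-- At `x` the edge `f` keeps its role, and at `y` it replaces `g`. If `x = y`, the non-loops `f`
and `g` become one loop, which counts twice. -/
lemma eDegree_smooth (hfg : f ≠ g) (hfx : H.IsLink f w x) (hgy : H.IsLink g w y)
    (hw : ∀ h, H.Inc h w → h = f ∨ h = g) (hv : v ≠ w) :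
    (H.smooth w f x y hf hx hy).eDegree v = H.eDegree v := by
  have hxw : x ≠ w := hx.2
  have hyw : y ≠ w := hy.2
  have hnl : ∀ e, (H.smooth w f x y hf hx hy).IsNonloopAt e v ↔
      (e ≠ f ∧ e ≠ g ∧ H.IsNonloopAt e v) ∨ (e = f ∧ x ≠ y ∧ (v = x ∨ v = y)) := by
    intro e
    constructor
    · rintro ⟨z, hzv, ⟨hvz, -, hzw⟩ | ⟨rfl, hs⟩⟩
      · have hne : ∀ {k u}, H.IsLink k w u → e ≠ k := by
          rintro k u hk rfl
          exact (hk.left_eq_or_eq hvz).elim (hv ·.symm) (hzw ·.symm)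
        exact .inl ⟨hne hfx, hne hgy, z, hzv, hvz⟩
      · rw [Sym2.eq_iff] at hs
        rcases hs with ⟨rfl, rfl⟩ | ⟨rfl, rfl⟩
        · exact .inr ⟨rfl, hzv.symm, .inl rfl⟩
        · exact .inr ⟨rfl, hzv, .inr rfl⟩
    · rintro (⟨hef, heg, z, hzv, hvz⟩ | ⟨rfl, hxy, rfl | rfl⟩)
      · refine ⟨z, hzv, .inl ⟨hvz, hv, ?_⟩⟩
        rintro rfl
        exact (hw e hvz.inc_right).elim hef heg
      · exact ⟨y, hxy.symm, .inr ⟨rfl, rfl⟩⟩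
      · exact ⟨x, hxy, .inr ⟨rfl, Sym2.eq_swap⟩⟩
  have hl : ∀ e, (H.smooth w f x y hf hx hy).IsLoopAt e v ↔
      H.IsLoopAt e v ∨ (e = f ∧ v = x ∧ v = y) := by
    intro e
    rw [← isLink_self_iff, smooth_isLink, Sym2.eq_iff, isLink_self_iff]
    tauto
  have hfv : H.IsNonloopAt f v ↔ v = x := by
    constructor
    · exact fun h ↦ h.inc.eq_of_isLink_of_ne_left hfx hv
    · rintro rfl
      exact ⟨w, hxw.symm, hfx.symm⟩
  have hgv : H.IsNonloopAt g v ↔ v = y := by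
    constructor
    · exact fun h ↦ h.inc.eq_of_isLink_of_ne_left hgy hv
    · rintro rfl
      exact ⟨w, hyw.symm, hgy.symm⟩
  have hflv : ¬ H.IsLoopAt f v := fun h ↦ hv (h.eq_of_inc hfx.inc_left)
  by_cases hvx : v = x
  · by_cases hvy : v = y
    · have h1 : {e | H.IsNonloopAt e v} =
          insert f (insert g {e | (H.smooth w f x y hf hx hy).IsNonloopAt e v}) := by
        ext e
        simp only [mem_ofPred_eq, mem_insert_iff, hnl]
        grind
      have h2 : {e | (H.smooth w f x y hf hx hy).IsLoopAt e v} =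
          insert f {e | H.IsLoopAt e v} := by
        ext e
        simp only [mem_ofPred_eq, mem_insert_iff, hl]
        tauto
      rw [eDegree, eDegree, h1, h2, encard_insert_of_notMem (by simpa using hflv),
        encard_insert_of_notMem, encard_insert_of_notMem]
      · ring
      · simp [hnl, hfg.symm]
      · simp only [mem_insert_iff, hfg, mem_ofPred_eq, hnl]
        grind
    · have h1 : {e | (H.smooth w f x y hf hx hy).IsNonloopAt e v} = {e | H.IsNonloopAt e v} := by
        ext e
        simp only [mem_ofPred_eq, hnl]
        grind
      have h2 : {e | (H.smooth w f x y hf hx hy).IsLoopAt e v} = {e | H.IsLoopAt e v} := by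
        ext e
        simp only [mem_ofPred_eq, hl]
        tauto
      rw [eDegree, eDegree, h1, h2]
  · have h2 : {e | (H.smooth w f x y hf hx hy).IsLoopAt e v} = {e | H.IsLoopAt e v} := by
      ext e
      simp only [mem_ofPred_eq, hl]
      tauto
    by_cases hvy : v = y
    · rw [eDegree, eDegree, h2, encard_congr_swap (f := f) (g := g) (N := {e | H.IsNonloopAt e v})]
      · simpa [hfv] using hvx
      · simpa [hgv] using hvy
      · intro e
        simp only [mem_ofPred_eq, hnl]
        grind
    · have h1 : {e | (H.smooth w f x y hf hx hy).IsNonloopAt e v} = {e | H.IsNonloopAt e v} := by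
        ext e
        simp only [mem_ofPred_eq, hnl]
        grind
      rw [eDegree, eDegree, h1, h2]

/-- Walks of `H` are pushed forward by moving `w` to a neighbour. To bypass an old edge, `w` goes to
`x`: `f` collapses and `g` becomes the new edge. To bypass the new edge, a walk from `w` to `x`
avoiding `f` is used and `w` goes to `y`, so that `g` collapses. -/
lemma isBridgeless_smooth (hH : H.IsBridgeless) (hfg : f ≠ g) (hfx : H.IsLink f w x)
    (hgy : H.IsLink g w y) (hw : ∀ h, H.Inc h w → h = f ∨ h = g) :
    (H.smooth w f x y hf hx hy).IsBridgeless := by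
  classical
  have hxw : x ≠ w := hx.2
  have hyw : y ≠ w := hy.2
  rintro h ⟨a, b, hab, hj⟩
  apply hj
  rw [smooth_isLink] at hab
  rcases hab with ⟨hab, ha, hb⟩ | ⟨rfl, hab⟩
  · have hhf : h ≠ f := by
      rintro rfl
      exact (hfx.left_eq_or_eq hab).elim (ha ·.symm) (hb ·.symm)
    have hHj : (H.deleteEdges {h}).Joined a b := by
      by_contra hn
      exact hH h ⟨a, b, hab, hn⟩
    have := hHj.map (H := (H.smooth w f x y hf hx hy).deleteEdges {h})
      (r := fun z ↦ if z = w then x else z) ?_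
    · simpa only [if_neg ha, if_neg hb] using this
    have hxy : ((H.smooth w f x y hf hx hy).deleteEdges {h}).Joined x y :=
      Relation.ReflTransGen.single ⟨f, (deleteEdges_isLink _ _ _ _ _).mpr ⟨.inr ⟨rfl, rfl⟩, hhf.symm⟩⟩
    have hstep : ∀ k d, k ≠ h → H.IsLink k w d →
        ((H.smooth w f x y hf hx hy).deleteEdges {h}).Joined x (if d = w then x else d) := by
      intro k d _ hk
      rcases hw k hk.inc_left with rfl | rfl
      · rw [hk.right_unique hfx, if_neg hxw]
        exact .refl
      · rw [hk.right_unique hgy, if_neg hyw]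
        exact hxy
    rintro c d ⟨k, hk⟩
    rw [deleteEdges_isLink] at hk
    by_cases hc : c = w
    · subst hc
      simpa using hstep k d hk.2 hk.1
    by_cases hd : d = w
    · subst hd
      simpa using (hstep k c hk.2 hk.1.symm).symm
    · simp only [if_neg hc, if_neg hd]
      exact .single ⟨k, (deleteEdges_isLink _ _ _ _ _).mpr ⟨.inl ⟨hk.1, hc, hd⟩, hk.2⟩⟩
  · have hHj : (H.deleteEdges {h}).Joined w x := by
      by_contra hn
      exact hH h ⟨w, x, hfx, hn⟩
    have := hHj.map (H := (H.smooth w h x y hf hx hy).deleteEdges {h})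
      (r := fun z ↦ if z = w then y else z) ?_
    · rw [if_pos rfl, if_neg hxw] at this
      rw [Sym2.eq_iff] at hab
      rcases hab with ⟨rfl, rfl⟩ | ⟨rfl, rfl⟩
      · exact this.symm
      · exact this
    have hstep : ∀ k d, k ≠ h → H.IsLink k w d → (if d = w then y else d) = y := by
      intro k d hkh hk
      obtain rfl := (hw k hk.inc_left).resolve_left hkh
      rw [hk.right_unique hgy, if_neg hyw]
    rintro c d ⟨k, hk⟩
    rw [deleteEdges_isLink] at hk
    by_cases hc : c = w
    · subst hc
      rw [if_pos rfl, hstep k d hk.2 hk.1]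
      exact .refl
    by_cases hd : d = w
    · subst hd
      rw [if_pos rfl, hstep k c hk.2 hk.1.symm]
      exact .refl
    · simp only [if_neg hc, if_neg hd]
      exact .single ⟨k, (deleteEdges_isLink _ _ _ _ _).mpr ⟨.inl ⟨hk.1, hc, hd⟩, hk.2⟩⟩

end Smooth

/-- A vertex of degree two can be smoothed out. This changes no other degree and creates no
bridge. -/
lemma IsBridgeless.exists_isSmoothing (hH : H.IsBridgeless) (hw : H.eDegree w = 2) :
    ∃ H' : Graph α β, H.IsSmoothing w H' ∧ V(H') = V(H) \ {w} ∧
      (∀ v ≠ w, H'.eDegree v = H.eDegree v) ∧ H'.IsBridgeless := by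
  rcases eDegree_eq_two hw with ⟨f, g, hfg, ⟨x, hxw, hx⟩, ⟨y, hyw, hy⟩, h⟩ | ⟨f, hf, h⟩
  · refine ⟨H.smooth w f x y hx.inc_left ⟨hx.right_mem, hxw⟩ ⟨hy.right_mem, hyw⟩,
      .inl ⟨f, g, x, y, hfg, hxw, hyw, hx, hy, h, rfl, fun h a b ↦ ?_⟩, rfl,
      fun v hv ↦ eDegree_smooth hfg hx hy h hv, isBridgeless_smooth hH hfg hx hy h⟩
    refine smooth_isLink.trans (or_congr_left ?_)
    rw [deleteVerts_isLink]
    rfl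
  · have hlink : ∀ {k a b}, H.IsLink k a b → a ≠ w → b ≠ w := by
      rintro k a b hk ha rfl
      obtain rfl := h k hk.inc_right
      exact ha (hf.isLink_iff_eq_and_eq.1 hk).1
    have hiff : ∀ {k a b}, a ≠ w → ((H.deleteVerts {w}).IsLink k a b ↔ H.IsLink k a b) := by
      intro k a b ha
      rw [deleteVerts_isLink]
      exact ⟨fun hk ↦ hk.1, fun hk ↦ ⟨hk, ha, hlink hk ha⟩⟩
    refine ⟨H.deleteVerts {w}, .inr ⟨f, hf, h, rfl⟩, by simp, fun v hv ↦ ?_, ?_⟩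
    · simp only [eDegree, IsNonloopAt, IsLoopAt, hiff hv]
    · rintro k ⟨a, b, hab, hj⟩
      have ha : a ≠ w := (deleteVerts_isLink .. |>.1 hab).2.1
      have hHj : (H.deleteEdges {k}).Joined a b := by
        by_contra hn
        exact hH k ⟨a, b, (hiff ha).1 hab, hn⟩
      suffices h : ((H.deleteVerts {w}).deleteEdges {k}).Joined a b ∧ b ≠ w from hj h.1
      clear hab hj
      induction hHj with
      | refl => exact ⟨.refl, ha⟩
      | tail _ hbc ih =>
        obtain ⟨l, hl⟩ := hbc
        rw [deleteEdges_isLink] at hl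
        exact ⟨ih.1.tail ⟨l, (deleteEdges_isLink _ _ _ _ _).mpr ⟨(hiff ih.2).2 hl.1, hl.2⟩⟩,
          hlink hl.1 ih.2⟩

lemma eDegree_deleteEdges_of_not_inc (h : ¬ G.Inc e v) :
    (G.deleteEdges {e}).eDegree v = G.eDegree v := by
  have h' : ∀ {f z}, G.IsLink f v z → f ≠ e := by
    rintro f z hf rfl
    exact h hf.inc_left
  have : ∀ {f z}, (G.deleteEdges {e}).IsLink f v z ↔ G.IsLink f v z := by
    intro f z
    rw [deleteEdges_isLink]
    exact ⟨fun hf ↦ hf.1, fun hf ↦ ⟨hf, h' hf⟩⟩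
  simp only [eDegree, IsNonloopAt, IsLoopAt, this]

lemma eDegree_deleteEdges_add_one (h : G.IsNonloopAt e v) :
    (G.deleteEdges {e}).eDegree v + 1 = G.eDegree v := by
  have h1 : {f | (G.deleteEdges {e}).IsNonloopAt f v} = {f | G.IsNonloopAt f v} \ {e} := by
    ext f
    simp only [mem_ofPred_eq, IsNonloopAt, deleteEdges_isLink, mem_sdiff]
    grind
  have h2 : {f | (G.deleteEdges {e}).IsLoopAt f v} = {f | G.IsLoopAt f v} := by
    ext f
    rw [mem_ofPred_eq, deleteEdges_isLoopAt, mem_ofPred_eq, and_iff_left_iff_imp]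
    rintro hf rfl
    exact h.not_isLoopAt v hf
  rw [eDegree, h1, h2, eDegree, ← encard_sdiff_singleton_add_one (s := {f | G.IsNonloopAt f v}) h]
  ring

/-- An edge whose deletion creates no bridge is admissible. -/
lemma IsBridgeless.isAdmissible (hG : G.IsBridgeless) (hcubic : G.IsCubic) (he : e ∈ E(G))
    (hGe : (G.deleteEdges {e}).IsBridgeless) : G.IsAdmissible e := by
  obtain ⟨u, v, huv⟩ := exists_isLink_of_mem_edgeSet he
  have hne : u ≠ v := by
    rintro rfl
    exact hG.not_isLoopAt (hcubic u huv.left_mem) huv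
  have htwo : ∀ {z}, G.IsNonloopAt e z → (G.deleteEdges {e}).eDegree z = 2 := by
    intro z hz
    have := eDegree_deleteEdges_add_one hz
    rw [hcubic z hz.vertex_mem] at this
    have hfin : (G.deleteEdges {e}).eDegree z ≠ ⊤ := fun h ↦ by simp [h] at this
    revert this
    lift (G.deleteEdges {e}).eDegree z to ℕ using hfin with n
    intro this
    norm_cast at this ⊢
    omega
  obtain ⟨H, hH, hHV, hHdeg, hHb⟩ := hGe.exists_isSmoothing (htwo ⟨v, hne.symm, huv⟩)
  -- If `u` and `v` were joined by three parallel edges, only a loop is left at `v`, and the second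
  -- kind of smoothing occurs.
  obtain ⟨G', hG', hGV, hGdeg, hGb⟩ := hHb.exists_isSmoothing (w := v)
    (by rw [hHdeg v hne.symm, htwo ⟨u, hne, huv.symm⟩])
  refine ⟨G', ⟨u, v, H, huv, hH, hG'⟩, fun z hz ↦ ?_, hGb⟩
  rw [hGV, hHV] at hz
  obtain ⟨⟨hzG, hzu⟩, hzv⟩ := hz
  have hinc : ¬ G.Inc e z := fun h ↦ (h.eq_or_eq_of_isLink huv).elim hzu hzv
  rw [hGdeg z hzv, hHdeg z hzu, eDegree_deleteEdges_of_not_inc hinc, hcubic z hzG]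

end Graph

open Graph in
theorem lemma2 {α β : Type*} (G : Graph α β)
    (hVfin : V(G).Finite) (hEfin : E(G).Finite) (hne : V(G).Nonempty)
    (hcubic : G.IsCubic) (hbridgeless : G.IsBridgeless)
    (D : G.PlaneEmbedding) (F : Set ℂ) (hF : D.IsFace F) :
    ∃ e, D.IsBoundaryEdge F e ∧ G.IsAdmissible e := by
  have hnl : ∀ {e v}, e ∈ G.cut {v} → G.IsNonloopAt e v := fun {e v} h ↦ by
    rwa [cut_singleton] at h
  have hdeg : ∀ v ∈ V(G), ∃ e p, G.IsNonloopAt e v ∧ G.Inc p v ∧ p ≠ e := by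
    intro v hv
    obtain ⟨e, f, g, hef, -, -, h⟩ := hbridgeless.exists_three_edges (hcubic v hv)
    exact ⟨e, f, hnl (h ▸ by simp), (hnl (h ▸ by simp)).inc, hef.symm⟩
  have hstep : ∀ e a, D.IsBoundaryEdge F e → G.Inc e a →
      ∃ q, q ≠ e ∧ G.Inc q a ∧ D.IsBoundaryEdge F q := by
    intro e a he hea
    have hloop := hbridgeless.not_isLoopAt (e := e) (hcubic a hea.vertex_mem)
    obtain ⟨p, hp, hpe⟩ : ∃ p ∈ G.cut {a}, p ≠ e := by
      obtain ⟨e₁, e₂, _, h12, -, -, h⟩ :=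
        hbridgeless.exists_three_edges (hcubic a hea.vertex_mem)
      by_cases h1 : e₁ = e
      · exact ⟨e₂, h ▸ by simp, fun h2 ↦ h12 (h1.trans h2.symm)⟩
      · exact ⟨e₁, h ▸ by simp, h1⟩
    exact hF.exists_isBoundaryEdge_inc hVfin hEfin
      (hea.isLoopAt_or_isNonloopAt.resolve_left hloop) (hnl hp).inc hpe (he.point_mem_frontier hea)
  obtain ⟨e, he, hGe⟩ := hbridgeless.exists_deleteEdges_isBridgeless hcubic hVfin hEfin
    (hF.exists_isBoundaryEdge hVfin hEfin hne hdeg) hstep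
  exact ⟨e, he, hbridgeless.isAdmissible hcubic he.1 hGe⟩
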